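/- Let $X=(X_t)_{t\ge 0}$ be a real-valued stochastic process on a probability space $(\Omega,\mathcal F,\mathbb P)$ (each $X_t$ is $\mathcal F$-measurable) whose paths $t\mapsto X_t(\omega)$ are, for almost every $\omega$, right-continuous on $[0,\infty)$. For a real random variable $Y$ let $\operatorname{supp}(Y)$ be the smallest closed set $F\subseteq\mathbb R$ with $\mathbb P(Y\in F)=1$, and let $$\operatorname{MSupp}(X)=\{(t,x)\in[0,\infty)\times\mathbb R : x\in\operatorname{supp}(X_t)\}$$ be the marginal support of $X$. Then, with probability $1$, $$\{(t,X_t): t\in[0,\infty)\}\subseteq\operatorname{MSupp}(X).$$ -/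

import Mathlib

open MeasureTheory Set
open scoped NNReal

noncomputable section

/-- The support of a real random variable `Y` under `P`: the support of its law. -/
def rvSupport {Ω : Type*} [MeasurableSpace Ω] (P : Measure Ω) (Y : Ω → ℝ) : Set ℝ :=
  (P.map Y).support

/-- The support of a real random variable is the smallest closed set that contains it with
probability one. -/
theorem rvSupport_isLeast {Ω : Type*} [MeasurableSpace Ω] (P : Measure Ω)
    [IsProbabilityMeasure P] (Y : Ω → ℝ) (hY : Measurable Y) :
    IsLeast {F : Set ℝ | IsClosed F ∧ P {ω | Y ω ∈ F} = 1} (rvSupport P Y) := by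
  have key : ∀ F : Set ℝ, IsClosed F → (P {ω | Y ω ∈ F} = 1 ↔ F ∈ ae (P.map Y)) := by
    intro F hF
    have := Measure.isProbabilityMeasure_map (μ := P) hY.aemeasurable
    rw [mem_ae_iff_prob_eq_one hF.measurableSet, Measure.map_apply hY hF.measurableSet]
    rfl
  refine ⟨⟨Measure.isClosed_support, ?_⟩, ?_⟩
  · exact (key _ Measure.isClosed_support).2 Measure.support_mem_ae
  · rintro F ⟨hF, h⟩
    exact Measure.support_subset_of_isClosed hF ((key F hF).1 h)

/-- The marginal support `{(t, x) : x ∈ supp (X_t)}` of a real process indexed by `[0, ∞)`. -/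
def marginalSupport {Ω : Type*} [MeasurableSpace Ω] (P : Measure Ω) (X : ℝ≥0 → Ω → ℝ) :
    Set (ℝ≥0 × ℝ) :=
  {p | p.2 ∈ rvSupport P (X p.1)}

/-- A path on `[0, ∞)` that is right-continuous at every time. -/
def RightContinuousPath (x : ℝ≥0 → ℝ) : Prop :=
  ∀ t : ℝ≥0, ContinuousWithinAt x (Ici t) t

end

/-!
Almost surely `X_t ∈ F` holds simultaneously for all `t` in a countable set of times, for each `F`
that contains every one of these `X_t` almost surely. Right-continuity extends this to uncountable
sets of times when `F` is closed, because an arbitrary set of times is separable for the topology of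
right neighbourhoods. It then suffices to let `F` run over the complements of a countable basis:
a point outside the support of the law of `X_t` lies in a basic open set that this law does not
charge.
-/

open scoped Topology

section RightContinuousProcess

variable {ι : Type*} [LinearOrder ι] [TopologicalSpace ι] [OrderTopology ι]
  [SecondCountableTopology ι]

theorem exists_countable_subset_forall_mem_closure_inter_Ici (T : Set ι) :
    ∃ D ⊆ T, D.Countable ∧ ∀ t ∈ T, t ∈ closure (D ∩ Ici t) := by
  let R := {t ∈ T | 𝓝[T ∩ Ioi t] t = ⊥}
  have hR : R.Countable := countable_setOfPred_isolated_right_within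
  obtain ⟨S, hST, hS, hTS⟩ :=
    (TopologicalSpace.IsSeparable.of_separableSpace T).exists_countable_dense_subset
  refine ⟨R ∪ S, union_subset (sep_subset _ _) hST, hR.union hS, fun t ht => ?_⟩
  by_cases isolated : 𝓝[T ∩ Ioi t] t = ⊥
  · exact subset_closure ⟨Or.inl ⟨ht, isolated⟩, self_mem_Ici⟩
  · have t_mem : t ∈ closure (T ∩ Ioi t) := mem_closure_iff_nhdsWithin_neBot.2 ⟨isolated⟩
    -- Since `Ioi t` is open, the ordinary density of `S` in `T` suffices here.
    have later_times : T ∩ Ioi t ⊆ closure (S ∩ Ioi t) := fun s hs =>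
      isOpen_Ioi.closure_inter ⟨hTS hs.1, hs.2⟩
    exact closure_mono (inter_subset_inter subset_union_right Ioi_subset_Ici_self)
      (closure_minimal later_times isClosed_closure t_mem)

variable {Ω E : Type*} [MeasurableSpace Ω] {P : Measure Ω} [TopologicalSpace E] {X : ι → Ω → E}

theorem ae_ball_mem_of_isClosed_of_rightContinuous
    (hrc : ∀ᵐ ω ∂P, ∀ t, ContinuousWithinAt (fun s => X s ω) (Ici t) t)
    {F : Set E} (hF : IsClosed F) {T : Set ι} (hT : ∀ t ∈ T, ∀ᵐ ω ∂P, X t ω ∈ F) :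
    ∀ᵐ ω ∂P, ∀ t ∈ T, X t ω ∈ F := by
  obtain ⟨D, hDT, hD, hTD⟩ := exists_countable_subset_forall_mem_closure_inter_Ici T
  have hDF : ∀ᵐ ω ∂P, ∀ d ∈ D, X d ω ∈ F := (ae_ball_iff hD).2 fun d hd => hT d (hDT hd)
  filter_upwards [hrc, hDF] with ω hω hωF t ht
  have hcont : ContinuousWithinAt (fun s => X s ω) (D ∩ Ici t) t := (hω t).mono inter_subset_right
  exact hF.closure_subset (hcont.mem_closure (hTD t ht) fun d hd => hωF d hd.1)

theorem mainTheorem6_general [SecondCountableTopology E] [MeasurableSpace E]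
    (hX : ∀ t, AEMeasurable (X t) P)
    (hrc : ∀ᵐ ω ∂P, ∀ t, ContinuousWithinAt (fun s => X s ω) (Ici t) t) :
    ∀ᵐ ω ∂P, ∀ t, X t ω ∈ (P.map (X t)).support := by
  have hB := TopologicalSpace.isBasis_countableBasis E
  have avoids_null : ∀ᵐ ω ∂P, ∀ U ∈ TopologicalSpace.countableBasis E,
      ∀ t ∈ {t | P.map (X t) U = 0}, X t ω ∈ Uᶜ :=
    (ae_ball_iff (TopologicalSpace.countable_countableBasis E)).2 fun U hU =>
      ae_ball_mem_of_isClosed_of_rightContinuous hrc (hB.isOpen hU).isClosed_compl fun t ht =>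
        ae_of_ae_map (hX t) (measure_eq_zero_iff_ae_notMem.1 ht)
  filter_upwards [avoids_null] with ω hω t
  by_contra h_notMem
  obtain ⟨U, ⟨hU, hXU⟩, hU_null⟩ := hB.nhds_hasBasis.notMem_measureSupport.1 h_notMem
  exact hω U hU t hU_null hXU

end RightContinuousProcess

theorem mainTheorem6 {Ω : Type*} [MeasurableSpace Ω] (P : Measure Ω) [IsProbabilityMeasure P]
    (X : ℝ≥0 → Ω → ℝ) (hX : ∀ t, Measurable (X t))
    (hrc : ∀ᵐ ω ∂P, RightContinuousPath (fun t => X t ω)) :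
    ∀ᵐ ω ∂P, Set.range (fun t : ℝ≥0 => (t, X t ω)) ⊆ marginalSupport P X := by
  filter_upwards [mainTheorem6_general (fun t => (hX t).aemeasurable) hrc] with ω hω
  exact range_subset_iff.2 hω
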